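/- Let $n\ge 0$ and let $\Theta$ be a real polynomial of total degree at most $2$ in $n$ variables. Identify the discrete cube $Q_n=\{0,1\}^n$ with the family of subsets of $[n]=\{1,\dots,n\}$ via indicator vectors; two vertices are neighbours if they differ in exactly one coordinate. Call $A\subseteq[n]$ a local maximum of $\Theta$ on $Q_n$ if the value of $\Theta$ at $A$ is strictly larger than its value at every neighbour of $A$, and let $\mathcal F$ be the family of all local maxima of $\Theta$ on $Q_n$. Put $c=0$ if $n$ is odd and $c=1$ if $n$ is even. If $$|\mathcal F|>\left(1-\frac{1}{n-c}\right)\binom{n}{\lfloor n/2\rfloor},$$ then there is a set $S\subseteq[n]$ such that, after applying the automorphism $A\mapsto A\,\Delta\,S$ of $Q_n$, the family $\{A\,\Delta\,S: A\in\mathcal F\}$ is an antichain with respect to inclusion. -/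

import Mathlib

open scoped symmDiff

/-- The vertex of the discrete cube `{0,1}^n` in `ℝ^n` that corresponds to `A ⊆ [n]`:
its indicator vector. -/
def cubeVertex {n : ℕ} (A : Finset (Fin n)) : Fin n → ℝ :=
  fun i => if i ∈ A then 1 else 0

/-- Two vertices of the cube are neighbours if they differ in exactly one coordinate. -/
def CubeAdj {n : ℕ} (A B : Finset (Fin n)) : Prop :=
  (A ∆ B).card = 1

/-- `A` is a strict local maximum of the polynomial function `Θ` on the cube: the value at `A`
is strictly larger than the value at every neighbour of `A`. -/
def IsStrictLocalMaxOnCube {n : ℕ} (Θ : MvPolynomial (Fin n) ℝ) (A : Finset (Fin n)) : Prop :=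
  ∀ B : Finset (Fin n), CubeAdj A B →
    MvPolynomial.eval (cubeVertex B) Θ < MvPolynomial.eval (cubeVertex A) Θ

/-- The set of strict local maxima of `Θ` on the cube, as a family of subsets of `[n]`. -/
def localMaxima {n : ℕ} (Θ : MvPolynomial (Fin n) ℝ) : Set (Finset (Fin n)) :=
  {A | IsStrictLocalMaxOnCube Θ A}

/-! At a local maximum every coordinate flip lowers `Θ`. Comparing these inequalities at two maxima
gives a symmetric zero-diagonal `J` whose quadratic form is positive on the difference of any two
maxima (`exists_form_pos_on_localMaxima`). If every product `J i j * J i k * J j k` over distinct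
indices is negative, a switching makes all entries nonpositive (`exists_switching`); comparable
switched sets would then have nonpositive form, so the switched family is an antichain. Otherwise
some triple has a nonnegative product, and its 3-cube is covered by two 4-element families with
pairwise nonpositive form. Doubling in the style of Kleitman adds the other `n - 3` coordinates, and
each final chain holds at most one maximum. Counting chains gives exactly the threshold
(`card_le_of_frustrated`). -/

/-! ### Counting descendants of a chain -/

/-- The number of chains obtained from a chain of `s` elements after `m` doublings, each of which
replaces a chain of length `s` by chains of lengths `s + 1` and `s - 1`; extended to an odd
function of `s : ℤ`. -/
def chainCount : ℕ → ℤ → ℤ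
  | 0, s => s.sign
  | m + 1, s => chainCount m (s + 1) + chainCount m (s - 1)

/-- The number of `±1` walks of length `m` from `0` to `k`. -/
def walkCount : ℕ → ℤ → ℤ
  | 0, k => if k = 0 then 1 else 0
  | m + 1, k => walkCount m (k + 1) + walkCount m (k - 1)

lemma chainCount_neg (m : ℕ) (s : ℤ) : chainCount m (-s) = -chainCount m s := by
  induction m generalizing s with
  | zero => simp [chainCount]
  | succ m ih =>
    have h1 := ih (s - 1)
    have h2 := ih (s + 1)
    simp only [chainCount]
    rw [show -s + 1 = -(s - 1) by ring, show -s - 1 = -(s + 1) by ring, h1, h2]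
    ring

lemma chainCount_at_zero (m : ℕ) : chainCount m 0 = 0 := by
  have := chainCount_neg m 0
  simp only [neg_zero] at this
  omega

lemma walkCount_eq_zero_of_lt (m : ℕ) (k : ℤ) (h : k < -m) : walkCount m k = 0 := by
  induction m generalizing k with
  | zero => simp only [walkCount]; rw [if_neg]; simp at h; omega
  | succ m ih =>
    push_cast at h
    simp only [walkCount]
    rw [ih _ (by omega), ih _ (by omega), add_zero]

lemma walkCount_eq_choose (m j : ℕ) : walkCount m (2 * j - m) = m.choose j := by
  induction m generalizing j with
  | zero =>
    cases j with
    | zero => simp [walkCount]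
    | succ j => simp only [walkCount]; rw [if_neg (by push_cast; omega)]; simp
  | succ m ih =>
    simp only [walkCount]
    cases j with
    | zero =>
      have := ih 0
      rw [walkCount_eq_zero_of_lt m (_ - 1) (by push_cast; omega), add_zero]
      rw [Nat.choose_zero_right] at this ⊢
      rw [← this]
      congr 1
      push_cast
      ring
    | succ j =>
      have h1 := ih j
      have h2 := ih (j + 1)
      rw [Nat.choose_succ_succ]
      push_cast at h2 ⊢
      rw [← h1, ← h2, add_comm]
      congr 2 <;> ring

lemma walkCount_eq_zero_of_odd (m : ℕ) (k : ℤ) (h : Odd (m + k)) : walkCount m k = 0 := by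
  induction m generalizing k with
  | zero =>
    simp only [walkCount]; rw [if_neg]; rintro rfl; simp at h
  | succ m ih =>
    simp only [walkCount]
    obtain ⟨r, hr⟩ := h
    push_cast at hr
    rw [ih _ ⟨r, by omega⟩, ih _ ⟨r - 1, by omega⟩, add_zero]

/-- Both sides obey the same linear recurrence in `m`, so only the base case matters. At `s = 0`
oddness turns the left side into `2 * chainCount m 1`. -/
lemma chainCount_sub (m : ℕ) (s : ℤ) :
    chainCount m (s + 1) - chainCount m (s - 1) = walkCount (m + 1) s + 2 * walkCount m s := by
  induction m generalizing s with
  | zero =>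
    simp only [chainCount, walkCount]
    rcases lt_trichotomy s 0 with h | rfl | h
    · rw [Int.sign_eq_neg_one_of_neg (show s - 1 < 0 by omega)]
      rcases eq_or_ne (s + 1) 0 with h' | h'
      · simp [h', h.ne, show s - 1 ≠ 0 by omega]
      · rw [Int.sign_eq_neg_one_of_neg (by omega)]
        simp [h', h.ne, show s - 1 ≠ 0 by omega]
    · simp
    · rw [Int.sign_eq_one_of_pos (show 0 < s + 1 by omega)]
      rcases eq_or_ne (s - 1) 0 with h' | h'
      · simp [h', h.ne', show s + 1 ≠ 0 by omega]
      · rw [Int.sign_eq_one_of_pos (by omega)]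
        simp [h', h.ne', show s + 1 ≠ 0 by omega]
  | succ m ih =>
    have h1 := ih (s + 1)
    have h2 := ih (s - 1)
    simp only [chainCount, walkCount, add_sub_cancel_right, sub_add_cancel] at *
    linarith

lemma chainCount_one (m : ℕ) : chainCount m 1 = m.choose (m / 2) := by
  have h := chainCount_sub m 0
  rw [zero_add, zero_sub, chainCount_neg] at h
  rcases Nat.even_or_odd' m with ⟨p, rfl | rfl⟩
  · rw [walkCount_eq_zero_of_odd (2 * p + 1) 0 ⟨p, by push_cast; ring⟩] at h
    have h' := walkCount_eq_choose (2 * p) p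
    rw [show 2 * (p : ℤ) - (2 * p : ℕ) = 0 by push_cast; ring] at h'
    rw [show 2 * p / 2 = p by omega]
    linarith
  · rw [walkCount_eq_zero_of_odd (2 * p + 1) 0 ⟨p, by push_cast; ring⟩] at h
    have h' := walkCount_eq_choose (2 * p + 1 + 1) (p + 1)
    rw [show 2 * ((p + 1 : ℕ) : ℤ) - (2 * p + 1 + 1 : ℕ) = 0 by push_cast; ring,
      Nat.choose_succ_succ, Nat.choose_symm_half] at h'
    rw [show (2 * p + 1) / 2 = p by omega]
    push_cast at h'
    linarith

/-- Unroll the recurrence from 1: three steps give `chainCount m 4 + 2 * chainCount m 2`, one step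
gives `chainCount m 2`. -/
lemma chainCount_four (m : ℕ) :
    chainCount m 4 = (m + 3).choose ((m + 3) / 2) - 2 * (m + 1).choose ((m + 1) / 2) := by
  have h1 := chainCount_one (m + 3)
  have h2 := chainCount_one (m + 1)
  have h0 := chainCount_at_zero
  simp only [chainCount] at h1 h2
  norm_num [h0] at h1 h2
  have h3 := chainCount_neg m 2
  linarith

lemma choose_half_recurrence_odd (p : ℕ) :
    (p + 2) * (2 * p + 3).choose (p + 1) = 2 * (2 * p + 3) * (2 * p + 1).choose p := by
  have h1 : (2 * p + 3) * (2 * p + 2).choose (p + 1) = (2 * p + 3).choose (p + 1) * (p + 2) := by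
    have := Nat.add_one_mul_choose_eq (2 * p + 2) (p + 1)
    rw [show 2 * p + 3 = 2 * (p + 1) + 1 by ring, ← Nat.choose_symm_half (p + 1)]
    exact this
  have h2 : (2 * p + 2).choose (p + 1) = 2 * (2 * p + 1).choose p := by
    rw [Nat.choose_succ_succ, Nat.choose_symm_half]; ring
  rw [h2] at h1
  linarith

lemma choose_half_recurrence_even (p : ℕ) :
    (p + 2) * (2 * p + 4).choose (p + 2) = 2 * (2 * p + 3) * (2 * p + 2).choose (p + 1) := by
  have := Nat.succ_mul_centralBinom_succ (p + 1)
  simp only [Nat.centralBinom] at this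
  exact this

/-- The bound from two 4-element chains is exactly the threshold for `n = m + 3`; the parity
correction comes from the two binomial recurrences. -/
lemma two_mul_chainCount_four (m : ℕ) :
    ((2 * chainCount m 4 : ℤ) : ℝ) =
      (1 - 1 / (((m + 3 : ℕ) : ℝ) - (if Odd (m + 3) then 0 else 1))) *
        ((m + 3).choose ((m + 3) / 2) : ℝ) := by
  rw [chainCount_four]
  rcases Nat.even_or_odd' m with ⟨p, rfl | rfl⟩
  · have h : Odd (2 * p + 3) := ⟨p + 1, by ring⟩
    have e := congrArg (Nat.cast (R := ℝ)) (choose_half_recurrence_odd p)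
    rw [if_pos h, show (2 * p + 3) / 2 = p + 1 by omega, show (2 * p + 1) / 2 = p by omega]
    push_cast at e ⊢
    have : (2 * (p : ℝ) + 3) ≠ 0 := by positivity
    rw [sub_zero]
    field_simp
    linarith
  · have h : ¬ Odd (2 * p + 1 + 3) := by rw [Nat.not_odd_iff_even]; exact ⟨p + 2, by ring⟩
    have e := congrArg (Nat.cast (R := ℝ)) (choose_half_recurrence_even p)
    rw [if_neg h, show 2 * p + 1 + 3 = 2 * p + 4 by ring, show 2 * p + 1 + 1 = 2 * p + 2 by ring,
      show (2 * p + 4) / 2 = p + 2 by omega, show (2 * p + 2) / 2 = p + 1 by omega]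
    push_cast at e ⊢
    have : (2 * (p : ℝ) + 4 - 1) ≠ 0 := by
      have : (0 : ℝ) ≤ p := Nat.cast_nonneg p
      linarith
    field_simp
    linarith

/-! ### Families of vertices on which a quadratic form is positive -/

open Matrix in
/-- The value of the quadratic form with matrix `J` at the difference of two cube vertices. -/
def differenceForm {n : ℕ} (J : Matrix (Fin n) (Fin n) ℝ) (A B : Finset (Fin n)) : ℝ :=
  (cubeVertex A - cubeVertex B) ⬝ᵥ (J *ᵥ (cubeVertex A - cubeVertex B))

section DifferenceForm

open Matrix

variable {n : ℕ} {J : Matrix (Fin n) (Fin n) ℝ}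

lemma quadratic_add_single (hJ : J.IsSymm) (hd : ∀ i, J i i = 0) (z : Fin n → ℝ) (t : Fin n)
    (c : ℝ) :
    (z + Pi.single t c) ⬝ᵥ (J *ᵥ (z + Pi.single t c)) =
      z ⬝ᵥ (J *ᵥ z) + 2 * c * (J t ⬝ᵥ z) := by
  have h1 : z ⬝ᵥ (J *ᵥ Pi.single t c) = c * (J t ⬝ᵥ z) := by
    rw [dotProduct_mulVec, dotProduct_single, ← mulVec_transpose, hJ.eq]
    exact mul_comm _ _
  have h2 : Pi.single t c ⬝ᵥ (J *ᵥ z) = c * (J t ⬝ᵥ z) := by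
    rw [single_dotProduct]; rfl
  have h3 : Pi.single t c ⬝ᵥ (J *ᵥ Pi.single t c) = 0 := by
    rw [single_dotProduct]
    change c * (J t ⬝ᵥ Pi.single t c) = 0
    rw [dotProduct_single, hd]; simp
  rw [mulVec_add, dotProduct_add, add_dotProduct, add_dotProduct, h1, h2, h3]
  ring

lemma differenceForm_comm (A B : Finset (Fin n)) :
    differenceForm J A B = differenceForm J B A := by
  unfold differenceForm
  rw [← neg_sub (cubeVertex B) (cubeVertex A), mulVec_neg, neg_dotProduct_neg]

lemma differenceForm_self (A : Finset (Fin n)) : differenceForm J A A = 0 := by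
  simp [differenceForm]

lemma cubeVertex_insert {A : Finset (Fin n)} {t : Fin n} (h : t ∉ A) :
    cubeVertex (insert t A) = cubeVertex A + Pi.single t 1 := by
  ext i
  rcases eq_or_ne i t with rfl | hi
  · simp [cubeVertex, h]
  · simp [cubeVertex, hi]

lemma differenceForm_insert_insert {A B : Finset (Fin n)} {t : Fin n} (hA : t ∉ A) (hB : t ∉ B) :
    differenceForm J (insert t A) (insert t B) = differenceForm J A B := by
  simp [differenceForm, cubeVertex_insert hA, cubeVertex_insert hB]

lemma differenceForm_insert_right (hJ : J.IsSymm) (hd : ∀ i, J i i = 0)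
    {A B : Finset (Fin n)} {t : Fin n} (hB : t ∉ B) :
    differenceForm J A (insert t B) =
      differenceForm J A B - 2 * (J t ⬝ᵥ cubeVertex A - J t ⬝ᵥ cubeVertex B) := by
  have h : cubeVertex A - (cubeVertex B + Pi.single t 1) =
      (cubeVertex A - cubeVertex B) + Pi.single t (-1) := by
    rw [Pi.single_neg]; abel
  rw [differenceForm, cubeVertex_insert hB, h, quadratic_add_single hJ hd, dotProduct_sub,
    differenceForm]
  ring

/-- A family of vertices of the cube such that no two of them can both belong to a family on which
the difference form is positive. -/
def IsFormChain (J : Matrix (Fin n) (Fin n) ℝ) (C : Finset (Finset (Fin n))) : Prop :=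
  ∀ A ∈ C, ∀ B ∈ C, differenceForm J A B ≤ 0

/-- Doubling a chain along a new coordinate `t`. -/
lemma IsFormChain.exists_double (hJ : J.IsSymm) (hd : ∀ i, J i i = 0)
    {C : Finset (Finset (Fin n))} (hC : IsFormChain J C) (hne : C.Nonempty) {t : Fin n}
    (ht : ∀ A ∈ C, t ∉ A) :
    ∃ C₁ C₂ : Finset (Finset (Fin n)), IsFormChain J C₁ ∧ IsFormChain J C₂ ∧
      C₁.card = C.card + 1 ∧ C₂.card + 1 = C.card ∧
      C₁ ∪ C₂ = C ∪ C.image (insert t) := by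
  -- Minimality makes the correction term in `differenceForm_insert_right` nonpositive, so the
  -- raised copy of `M` can join the lower layer.
  obtain ⟨M, hM, hmin⟩ := C.exists_min_image (fun A => J t ⬝ᵥ cubeVertex A) hne
  have hnot : ∀ B, insert t B ∉ C := fun B hB => ht _ hB (Finset.mem_insert_self _ _)
  refine ⟨insert (insert t M) C, (C.erase M).image (insert t), ?_, ?_, ?_, ?_, ?_⟩
  · have key : ∀ A ∈ C, differenceForm J A (insert t M) ≤ 0 := fun A hA => by
      rw [differenceForm_insert_right hJ hd (ht M hM)]
      have h1 := hC A hA M hM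
      have h2 := hmin A hA
      linarith
    intro A hA B hB
    rcases Finset.mem_insert.1 hA with rfl | hA <;> rcases Finset.mem_insert.1 hB with rfl | hB
    · rw [differenceForm_self]
    · rw [differenceForm_comm]; exact key B hB
    · exact key A hA
    · exact hC A hA B hB
  · intro A hA B hB
    obtain ⟨A, hA', rfl⟩ := Finset.mem_image.1 hA
    obtain ⟨B, hB', rfl⟩ := Finset.mem_image.1 hB
    have hA := Finset.mem_of_mem_erase hA'
    have hB := Finset.mem_of_mem_erase hB'
    rw [differenceForm_insert_insert (ht A hA) (ht B hB)]
    exact hC A hA B hB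
  · exact Finset.card_insert_of_notMem (hnot M)
  · rw [Finset.card_image_of_injOn, Finset.card_erase_add_one hM]
    intro A hA B hB h
    have hA := Finset.mem_of_mem_erase hA
    have hB := Finset.mem_of_mem_erase hB
    have := congrArg (fun X => X.erase t) h
    simpa [Finset.erase_insert (ht A hA), Finset.erase_insert (ht B hB)] using this
  · ext X
    simp only [Finset.mem_union, Finset.mem_insert, Finset.mem_image, Finset.mem_erase]
    constructor
    · rintro ((rfl | h) | ⟨A, ⟨-, hA⟩, rfl⟩)
      · exact Or.inr ⟨M, hM, rfl⟩
      · exact Or.inl h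
      · exact Or.inr ⟨A, hA, rfl⟩
    · rintro (h | ⟨A, hA, rfl⟩)
      · exact Or.inl (Or.inr h)
      · by_cases hAM : A = M
        · subst hAM; exact Or.inl (Or.inl rfl)
        · exact Or.inr ⟨A, ⟨hAM, hA⟩, rfl⟩

/-- A family with positive difference form meets the cylinder over a chain of `s` vertices of the
subcube on `T` in at most `chainCount m s` elements, where `m` is the number of remaining
coordinates. -/
lemma IsFormChain.card_filter_le (hJ : J.IsSymm) (hd : ∀ i, J i i = 0)
    {F : Finset (Finset (Fin n))} (hF : ∀ A ∈ F, ∀ B ∈ F, A ≠ B → 0 < differenceForm J A B)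
    (m : ℕ) {T : Finset (Fin n)} (hT : Tᶜ.card = m) {C : Finset (Finset (Fin n))}
    (hC : IsFormChain J C) (hCT : ∀ A ∈ C, A ⊆ T) :
    ((F.filter (fun A => A ∩ T ∈ C)).card : ℤ) ≤ chainCount m C.card := by
  induction m generalizing T C with
  | zero =>
    have hT : T = Finset.univ := by simpa using hT
    subst hT
    simp only [Finset.inter_univ, chainCount]
    rcases C.eq_empty_or_nonempty with rfl | hne
    · simp
    · rw [Int.sign_eq_one_of_pos (by exact_mod_cast hne.card_pos)]
      norm_cast
      rw [Finset.card_le_one]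
      intro A hA B hB
      rw [Finset.mem_filter] at hA hB
      by_contra hAB
      exact absurd (hC A hA.2 B hB.2) (not_le.2 (hF A hA.1 B hB.1 hAB))
  | succ m ih =>
    -- Doubling a singleton leaves an empty second chain, so this case does arise.
    rcases C.eq_empty_or_nonempty with rfl | hne
    · simp [chainCount_at_zero]
    obtain ⟨t, ht⟩ : Tᶜ.Nonempty := Finset.card_pos.1 (by omega)
    have htT : t ∉ T := Finset.mem_compl.1 ht
    have htC : ∀ A ∈ C, t ∉ A := fun A hA h => htT (hCT A hA h)
    obtain ⟨C₁, C₂, h₁, h₂, hc₁, hc₂, hU⟩ := hC.exists_double hJ hd hne htC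
    have hcard : (insert t T)ᶜ.card = m := by
      rw [Finset.compl_insert, Finset.card_erase_of_mem ht, hT]; rfl
    have hsub : ∀ A ∈ C₁ ∪ C₂, A ⊆ insert t T := by
      rw [hU]
      intro A hA
      rcases Finset.mem_union.1 hA with hA | hA
      · exact (hCT A hA).trans (Finset.subset_insert _ _)
      · obtain ⟨B, hB, rfl⟩ := Finset.mem_image.1 hA
        exact Finset.insert_subset_insert _ (hCT B hB)
    have i₁ := ih hcard h₁ fun A hA => hsub A (Finset.mem_union_left _ hA)
    have i₂ := ih hcard h₂ fun A hA => hsub A (Finset.mem_union_right _ hA)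
    have hcover : F.filter (fun A => A ∩ T ∈ C) ⊆
        F.filter (fun A => A ∩ insert t T ∈ C₁) ∪ F.filter (fun A => A ∩ insert t T ∈ C₂) := by
      intro A hA
      rw [Finset.mem_filter] at hA
      rw [← Finset.filter_or, Finset.mem_filter]
      refine ⟨hA.1, ?_⟩
      rw [← Finset.mem_union, hU, Finset.mem_union]
      by_cases htA : t ∈ A
      · right
        rw [Finset.inter_insert_of_mem htA]
        exact Finset.mem_image_of_mem _ hA.2
      · left
        rw [Finset.inter_insert_of_notMem htA]
        exact hA.2
    have hle := (Finset.card_le_card hcover).trans (Finset.card_union_le _ _)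
    rw [show ((C₁.card : ℕ) : ℤ) = C.card + 1 by exact_mod_cast hc₁] at i₁
    rw [show ((C₂.card : ℕ) : ℤ) = C.card - 1 by omega] at i₂
    simp only [chainCount]
    have hle : ((F.filter (fun A => A ∩ T ∈ C)).card : ℤ) ≤
        (F.filter (fun A => A ∩ insert t T ∈ C₁)).card +
        (F.filter (fun A => A ∩ insert t T ∈ C₂)).card := by exact_mod_cast hle
    linarith

/-! ### Balls in a frustrated triple -/

/-- The sign `±1` of a coordinate at a vertex of the cube. -/
def vertexSign (c : Finset (Fin n)) (i : Fin n) : ℝ := if i ∈ c then 1 else -1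

/-- The ball of radius one about `c` in the subcube of subsets of `T`. -/
def cubeBall (T c : Finset (Fin n)) : Finset (Finset (Fin n)) :=
  insert c (T.image fun a => c ∆ {a})

lemma mem_cubeBall_iff {T c X : Finset (Fin n)} (hX : X ⊆ T) (hc : c ⊆ T) :
    X ∈ cubeBall T c ↔ (c ∆ X).card ≤ 1 := by
  have hs : c ∆ X ⊆ T := symmDiff_le (hc.trans le_sup_right) (hX.trans le_sup_right)
  rw [cubeBall, Finset.mem_insert, Finset.mem_image, Nat.le_one_iff_eq_zero_or_eq_one,
    Finset.card_eq_zero, Finset.card_eq_one, ← Finset.bot_eq_empty, symmDiff_eq_bot, eq_comm]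
  refine or_congr Iff.rfl ⟨?_, ?_⟩
  · rintro ⟨a, -, rfl⟩
    exact ⟨a, symmDiff_symmDiff_cancel_left _ _⟩
  · rintro ⟨a, ha⟩
    refine ⟨a, hs (ha ▸ Finset.mem_singleton_self a), ?_⟩
    rw [← ha, symmDiff_symmDiff_cancel_left]

lemma card_cubeBall (T c : Finset (Fin n)) : (cubeBall T c).card = T.card + 1 := by
  rw [cubeBall, Finset.card_insert_of_notMem, Finset.card_image_of_injective]
  · intro a b h
    simpa using symmDiff_right_injective c h
  · simp only [Finset.mem_image, not_exists, not_and]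
    intro a _ h
    have := symmDiff_eq_left.1 h
    simp at this

lemma cubeVertex_symmDiff_singleton (c : Finset (Fin n)) (a : Fin n) :
    cubeVertex (c ∆ {a}) = cubeVertex c + Pi.single a (-vertexSign c a) := by
  ext i
  rcases eq_or_ne i a with rfl | hi
  · by_cases h : i ∈ c <;> simp [cubeVertex, vertexSign, Finset.mem_symmDiff, h]
  · by_cases h : i ∈ c <;> simp [cubeVertex, Finset.mem_symmDiff, h, hi]

/-- The zero diagonal kills the form between centre and neighbour; between the neighbours along `a`
and `b` it is `-2` times the expression in `h`. -/
lemma isFormChain_cubeBall (hJ : J.IsSymm) (hd : ∀ i, J i i = 0) {T c : Finset (Fin n)}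
    (h : ∀ a ∈ T, ∀ b ∈ T, 0 ≤ vertexSign c a * vertexSign c b * J a b) :
    IsFormChain J (cubeBall T c) := by
  have h1 : ∀ a, differenceForm J (c ∆ {a}) c = 0 := fun a => by
    have := quadratic_add_single hJ hd 0 a (-vertexSign c a)
    simp only [zero_add, zero_dotProduct, dotProduct_zero, mul_zero, add_zero] at this
    rw [differenceForm, cubeVertex_symmDiff_singleton, add_sub_cancel_left, this]
  have h2 : ∀ a ∈ T, ∀ b ∈ T, differenceForm J (c ∆ {a}) (c ∆ {b}) ≤ 0 := fun a ha b hb => by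
    have e : cubeVertex (c ∆ {a}) - cubeVertex (c ∆ {b}) =
        0 + Pi.single a (-vertexSign c a) + Pi.single b (vertexSign c b) := by
      rw [cubeVertex_symmDiff_singleton, cubeVertex_symmDiff_singleton,
        Pi.single_neg b]
      abel
    rw [differenceForm, e, quadratic_add_single hJ hd, quadratic_add_single hJ hd]
    simp only [zero_add, zero_dotProduct, dotProduct_zero, mul_zero, dotProduct_single]
    have := h b hb a ha
    linarith
  intro A hA B hB
  rw [cubeBall, Finset.mem_insert, Finset.mem_image] at hA hB
  rcases hA with rfl | ⟨a, ha, rfl⟩ <;> rcases hB with rfl | ⟨b, hb, rfl⟩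
  · rw [differenceForm_self]
  · rw [differenceForm_comm, h1]
  · rw [h1]
  · exact h2 a ha b hb

/-- The distances from `X` to two antipodes of a 3-cube sum to 3, so one is at most 1. -/
lemma mem_cubeBall_or_mem_cubeBall_sdiff {T c X : Finset (Fin n)} (hT : T.card = 3) (hc : c ⊆ T)
    (hX : X ⊆ T) : X ∈ cubeBall T c ∨ X ∈ cubeBall T (T \ c) := by
  rw [mem_cubeBall_iff hX hc, mem_cubeBall_iff hX Finset.sdiff_subset]
  have e : (T \ c) ∆ X = T \ (c ∆ X) := by
    ext i
    have := @hc i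
    have := @hX i
    simp only [Finset.mem_symmDiff, Finset.mem_sdiff]
    tauto
  have hs : c ∆ X ⊆ T := fun i hi => by
    rcases Finset.mem_symmDiff.1 hi with h | h
    · exact hc h.1
    · exact hX h.1
  rw [e, Finset.card_sdiff_of_subset hs]
  omega

lemma exists_signs {x y z : ℝ} (h : 0 ≤ x * y * z) :
    ∃ p q r : Bool, 0 ≤ (if p then (1 : ℝ) else -1) * (if q then 1 else -1) * x ∧
      0 ≤ (if p then (1 : ℝ) else -1) * (if r then 1 else -1) * y ∧
      0 ≤ (if q then (1 : ℝ) else -1) * (if r then 1 else -1) * z := by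
  have key : ∀ w : ℝ, 0 ≤ (if decide (0 ≤ w) = true then (1 : ℝ) else -1) * w := fun w => by
    by_cases hw : 0 ≤ w
    · simp [hw]
    · simp [hw, (not_le.1 hw).le]
  rcases eq_or_ne x 0 with rfl | hx
  · exact ⟨decide (0 ≤ y), decide (0 ≤ z), true, by simp, by simpa using key y,
      by simpa using key z⟩
  rcases eq_or_ne y 0 with rfl | hy
  · exact ⟨decide (0 ≤ x), true, decide (0 ≤ z), by simpa using key x, by simp,
      by simpa using key z⟩
  -- With the signs of `x` and `y` chosen, the third product inherits the sign of `x * y * z`.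
  refine ⟨true, decide (0 ≤ x), decide (0 ≤ y), by simpa using key x, by simpa using key y, ?_⟩
  rcases hx.lt_or_gt with hx | hx <;> rcases hy.lt_or_gt with hy | hy
  · simpa [hx.not_ge, hy.not_ge] using nonneg_of_mul_nonneg_right h (mul_pos_of_neg_of_neg hx hy)
  · simpa [hx.not_ge, hy.le] using nonpos_of_mul_nonneg_right h (mul_neg_of_neg_of_pos hx hy)
  · simpa [hx.le, hy.not_ge] using nonpos_of_mul_nonneg_right h (mul_neg_of_pos_of_neg hx hy)
  · simpa [hx.le, hy.le] using nonneg_of_mul_nonneg_right h (mul_pos hx hy)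

lemma exists_center (hJ : J.IsSymm) (hd : ∀ i, J i i = 0) {i j k : Fin n} (hij : i ≠ j)
    (hik : i ≠ k) (hjk : j ≠ k) (h : 0 ≤ J i j * J i k * J j k) :
    ∃ c ⊆ ({i, j, k} : Finset (Fin n)), ∀ a ∈ ({i, j, k} : Finset (Fin n)),
      ∀ b ∈ ({i, j, k} : Finset (Fin n)), 0 ≤ vertexSign c a * vertexSign c b * J a b := by
  obtain ⟨p, q, r, h1, h2, h3⟩ := exists_signs h
  refine ⟨({i, j, k} : Finset (Fin n)).filter
    fun a => (a = i ∧ p) ∨ (a = j ∧ q) ∨ (a = k ∧ r), Finset.filter_subset _ _, ?_⟩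
  have e1 := hJ.apply i j
  have e2 := hJ.apply i k
  have e3 := hJ.apply j k
  intro a ha b hb
  simp only [Finset.mem_insert, Finset.mem_singleton] at ha hb
  rcases ha with rfl | rfl | rfl <;> rcases hb with rfl | rfl | rfl <;>
    simp_all [vertexSign, hij.symm, hik.symm, hjk.symm, mul_comm]

lemma card_le_of_frustrated (hJ : J.IsSymm) (hd : ∀ i, J i i = 0)
    {F : Finset (Finset (Fin n))} (hF : ∀ A ∈ F, ∀ B ∈ F, A ≠ B → 0 < differenceForm J A B)
    {i j k : Fin n} (hij : i ≠ j) (hik : i ≠ k) (hjk : j ≠ k)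
    (h : 0 ≤ J i j * J i k * J j k) :
    (F.card : ℝ) ≤
      (1 - 1 / ((n : ℝ) - (if Odd n then 0 else 1))) * (n.choose (n / 2) : ℝ) := by
  obtain ⟨c, hc, hs⟩ := exists_center hJ hd hij hik hjk h
  set T : Finset (Fin n) := {i, j, k} with hTdef
  have hT : T.card = 3 := Finset.card_eq_three.2 ⟨i, j, k, hij, hik, hjk, rfl⟩
  have hn : 3 ≤ n := by
    have := Finset.card_le_univ T
    simpa [hT] using this
  -- Passing to the antipode flips every sign on `T`, which leaves pairwise products unchanged.
  have hs' : ∀ a ∈ T, ∀ b ∈ T, 0 ≤ vertexSign (T \ c) a * vertexSign (T \ c) b * J a b := by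
    have e : ∀ a ∈ T, vertexSign (T \ c) a = -vertexSign c a := fun a ha => by
      by_cases hac : a ∈ c <;> simp [vertexSign, ha, hac]
    intro a ha b hb
    rw [e a ha, e b hb, neg_mul_neg]
    exact hs a ha b hb
  have hsub : ∀ {d}, d ⊆ T → ∀ A ∈ cubeBall T d, A ⊆ T := by
    intro d hd A hA
    rw [cubeBall, Finset.mem_insert, Finset.mem_image] at hA
    rcases hA with rfl | ⟨a, ha, rfl⟩
    · exact hd
    · intro x hx
      rcases Finset.mem_symmDiff.1 hx with hx | hx
      · exact hd hx.1
      · rwa [Finset.mem_singleton.1 hx.1]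
  have hTc : Tᶜ.card = n - 3 := by rw [Finset.card_compl, hT, Fintype.card_fin]
  have b1 := (isFormChain_cubeBall hJ hd hs).card_filter_le hJ hd hF _ hTc (hsub hc)
  have b2 := (isFormChain_cubeBall hJ hd hs').card_filter_le hJ hd hF _ hTc
    (hsub Finset.sdiff_subset)
  have hcover : F ⊆ F.filter (fun A => A ∩ T ∈ cubeBall T c) ∪
      F.filter (fun A => A ∩ T ∈ cubeBall T (T \ c)) := by
    intro A hA
    rw [← Finset.filter_or, Finset.mem_filter]
    exact ⟨hA, mem_cubeBall_or_mem_cubeBall_sdiff hT hc Finset.inter_subset_right⟩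
  have hle := (Finset.card_le_card hcover).trans (Finset.card_union_le _ _)
  rw [card_cubeBall, hT] at b1 b2
  norm_num at b1 b2
  have hle : (F.card : ℤ) ≤ 2 * chainCount (n - 3) 4 := by
    have : (F.card : ℤ) ≤ (F.filter (fun A => A ∩ T ∈ cubeBall T c)).card +
      (F.filter (fun A => A ∩ T ∈ cubeBall T (T \ c))).card := by exact_mod_cast hle
    linarith
  have hfin := two_mul_chainCount_four (n - 3)
  rw [Nat.sub_add_cancel hn] at hfin
  rw [← hfin]
  exact_mod_cast hle

/-! ### Switching -/

lemma isAntichain_image_symmDiff {S : Finset (Fin n)}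
    (hS : ∀ i j, vertexSign S i * vertexSign S j * J i j ≤ 0) {F : Set (Finset (Fin n))}
    (hF : ∀ A ∈ F, ∀ B ∈ F, A ≠ B → 0 < differenceForm J A B) :
    IsAntichain (· ⊆ ·) ((fun A : Finset (Fin n) => A ∆ S) '' F) := by
  rintro _ ⟨A, hA, rfl⟩ _ ⟨B, hB, rfl⟩ hne hsub
  have hAB : A ≠ B := by rintro rfl; exact hne rfl
  have hpos := hF A hA B hB hAB
  have hz : ∀ i, ∃ d : ℝ, 0 ≤ d ∧ (cubeVertex A - cubeVertex B) i = d * vertexSign S i := by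
    intro i
    have h := @hsub i
    simp only [Finset.mem_symmDiff] at h
    by_cases hi : i ∈ A ↔ i ∈ B
    · exact ⟨0, le_rfl, by simp [cubeVertex, hi]⟩
    · refine ⟨1, zero_le_one, ?_⟩
      by_cases hiS : i ∈ S
      · have hA : i ∈ A := by tauto
        have hB : i ∉ B := by tauto
        simp [cubeVertex, vertexSign, hA, hB, hiS]
      · have hA : i ∉ A := by tauto
        have hB : i ∈ B := by tauto
        simp [cubeVertex, vertexSign, hA, hB, hiS]
  choose d hd0 hd using hz
  refine absurd hpos (not_lt.2 ?_)
  rw [differenceForm]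
  simp only [dotProduct, mulVec, Finset.mul_sum]
  refine Finset.sum_nonpos fun i _ => Finset.sum_nonpos fun j _ => ?_
  rw [hd i, hd j]
  have := mul_nonneg (mul_nonneg (hd0 i) (hd0 j)) (neg_nonneg.2 (hS i j))
  linarith

/-- The row of `o` dictates the signs; a bad pair `i`, `j` would make the triple product with `o`
nonnegative, as each sign enters it squared. -/
lemma exists_switching (hJ : J.IsSymm) (hd : ∀ i, J i i = 0) (o : Fin n)
    (h : ∀ i j k, i ≠ j → i ≠ k → j ≠ k → J i j * J i k * J j k < 0) :
    ∃ S : Finset (Fin n), ∀ i j, vertexSign S i * vertexSign S j * J i j ≤ 0 := by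
  refine ⟨Finset.univ.filter fun i => 0 < J o i, ?_⟩
  set S := Finset.univ.filter fun i => 0 < J o i
  have hmem : ∀ i, i ∈ S ↔ 0 < J o i := by simp [S]
  have ho : vertexSign S o = -1 := by simp [vertexSign, hmem, hd]
  have h0 : ∀ j, 0 ≤ vertexSign S j * J o j := fun j => by
    by_cases hj : 0 < J o j
    · simp [vertexSign, hmem, hj, hj.le]
    · simp [vertexSign, hmem, hj, not_lt.1 hj]
  intro i j
  rcases eq_or_ne i j with rfl | hij
  · simp [hd]
  rcases eq_or_ne i o with rfl | hi
  · have := h0 j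
    rw [ho]
    linarith
  rcases eq_or_ne j o with rfl | hj
  · have := h0 i
    rw [ho, ← hJ.apply]
    linarith
  have ht := h o i j hi.symm hj.symm hij
  have hi0 := h0 i
  have hj0 := h0 j
  have hsq : ∀ a, vertexSign S a * vertexSign S a = 1 := fun a => by
    by_cases ha : a ∈ S <;> simp [vertexSign, ha]
  by_contra hcon
  push Not at hcon
  have hp := mul_nonneg (mul_nonneg hi0 hj0) hcon.le
  have e : vertexSign S i * J o i * (vertexSign S j * J o j) *
      (vertexSign S i * vertexSign S j * J i j) =
      (vertexSign S i * vertexSign S i) * (vertexSign S j * vertexSign S j) *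
        (J o i * J o j * J i j) := by ring
  rw [e, hsq, hsq] at hp
  linarith

end DifferenceForm

/-! ### Quadratic polynomials -/

lemma MvPolynomial.exists_quadratic_of_totalDegree_le_two {n : ℕ} (Θ : MvPolynomial (Fin n) ℝ)
    (hΘ : Θ.totalDegree ≤ 2) :
    ∃ (c : ℝ) (b : Fin n → ℝ) (M : Matrix (Fin n) (Fin n) ℝ), ∀ x : Fin n → ℝ,
      MvPolynomial.eval x Θ = c + b ⬝ᵥ x + x ⬝ᵥ (M.mulVec x) := by
  rw [Θ.as_sum]
  refine Finset.sum_induction _ (fun p : MvPolynomial (Fin n) ℝ =>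
    ∃ (c : ℝ) (b : Fin n → ℝ) (M : Matrix (Fin n) (Fin n) ℝ), ∀ x : Fin n → ℝ,
      MvPolynomial.eval x p = c + b ⬝ᵥ x + x ⬝ᵥ (M.mulVec x)) ?_ ⟨0, 0, 0, by simp⟩ ?_
  · rintro p q ⟨c, b, M, h⟩ ⟨c', b', M', h'⟩
    refine ⟨c + c', b + b', M + M', fun x => ?_⟩
    rw [map_add, h, h', add_dotProduct, Matrix.add_mulVec, dotProduct_add]
    ring
  · intro s hs
    have hdeg : (Finsupp.toMultiset s).card ≤ 2 := by
      rw [Finsupp.card_toMultiset]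
      exact (MvPolynomial.le_totalDegree hs).trans hΘ
    set a := MvPolynomial.coeff s Θ
    obtain ⟨t, rfl⟩ : ∃ t, s = Multiset.toFinsupp t :=
      ⟨Finsupp.toMultiset s, (Finsupp.toMultiset_toFinsupp s).symm⟩
    rw [Multiset.toFinsupp_toMultiset] at hdeg
    have hcases : t.card = 0 ∨ t.card = 1 ∨ t.card = 2 := by omega
    rcases hcases with h | h | h
    · rw [Multiset.card_eq_zero] at h
      subst h
      exact ⟨a, 0, 0, fun x => by simp⟩
    · obtain ⟨i, rfl⟩ := Multiset.card_eq_one.1 h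
      exact ⟨0, Pi.single i a, 0, fun x => by
        simp [Multiset.toFinsupp_singleton, MvPolynomial.eval_monomial]⟩
    · obtain ⟨i, j, rfl⟩ := Multiset.card_eq_two.1 h
      refine ⟨0, 0, Matrix.single i j a, fun x => ?_⟩
      rw [Multiset.insert_eq_cons, ← Multiset.singleton_add, map_add,
        Multiset.toFinsupp_singleton, Multiset.toFinsupp_singleton, ← mul_one a,
        ← MvPolynomial.monomial_mul, map_mul]
      have e : Function.update (0 : Fin n → ℝ) i (a * x j) = Pi.single i (a * x j) := rfl
      simp [MvPolynomial.eval_monomial, Matrix.single_mulVec, e]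
      ring

lemma exists_form_pos_on_localMaxima {n : ℕ} (Θ : MvPolynomial (Fin n) ℝ)
    (hΘ : Θ.totalDegree ≤ 2) :
    ∃ J : Matrix (Fin n) (Fin n) ℝ, J.IsSymm ∧ (∀ i, J i i = 0) ∧
      ∀ A ∈ localMaxima Θ, ∀ B ∈ localMaxima Θ, A ≠ B → 0 < differenceForm J A B := by
  obtain ⟨c, b, M, hM⟩ := Θ.exists_quadratic_of_totalDegree_le_two hΘ
  -- On the cube squares of coordinates are linear, so the diagonal of `M` moves into the linear
  -- part.
  set J : Matrix (Fin n) (Fin n) ℝ := M + M.transpose - Matrix.diagonal fun i => 2 * M i i with hJ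
  have hJmul : ∀ x i, J.mulVec x i = M.mulVec x i + Matrix.vecMul x M i - 2 * M i i * x i := by
    intro x i
    rw [hJ, Matrix.sub_mulVec, Matrix.add_mulVec, Matrix.mulVec_transpose, Pi.sub_apply,
      Pi.add_apply, Matrix.mulVec_diagonal]
  -- The positive quantity is the drop in `Θ` when coordinate `i` of `A` is flipped.
  have key : ∀ A ∈ localMaxima Θ, ∀ i,
      0 < vertexSign A i * (b i + M i i + J.mulVec (cubeVertex A) i) := by
    intro A hA i
    have hlt := hA (A ∆ {i}) (by simp [CubeAdj])
    rw [hM, hM, cubeVertex_symmDiff_singleton, Matrix.mulVec_add, dotProduct_add, dotProduct_add,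
      add_dotProduct, add_dotProduct, Matrix.dotProduct_mulVec _ _ (Pi.single _ _)] at hlt
    rw [hJmul]
    simp only [dotProduct_single, single_dotProduct, Matrix.mulVec_single] at hlt
    have hx : cubeVertex A i = (1 + vertexSign A i) / 2 := by
      by_cases h : i ∈ A <;> simp [cubeVertex, vertexSign, h]
    have hsq : vertexSign A i * vertexSign A i = 1 := by
      by_cases h : i ∈ A <;> simp [vertexSign, h]
    rw [hx]
    simp at hlt
    nlinarith
  refine ⟨J, ?_, fun i => ?_, fun A hA B hB hAB => ?_⟩
  · rw [hJ, Matrix.IsSymm, Matrix.transpose_sub, Matrix.transpose_add, Matrix.transpose_transpose,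
      Matrix.diagonal_transpose, add_comm]
  · simp only [hJ, Matrix.sub_apply, Matrix.add_apply, Matrix.transpose_apply,
      Matrix.diagonal_apply_eq]
    ring
  -- Where `A` and `B` differ their signs are opposite, so adding the two inequalities cancels `b i
  -- + M i i`.
  · have hterm : ∀ i, (i ∈ A ↔ i ∉ B) → 0 < (cubeVertex A - cubeVertex B) i *
        J.mulVec (cubeVertex A - cubeVertex B) i := by
      intro i hi
      have h1 := key A hA i
      have h2 := key B hB i
      rw [Matrix.mulVec_sub, Pi.sub_apply, Pi.sub_apply]
      by_cases hiB : i ∈ B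
      · have hiA : i ∉ A := by tauto
        simp only [vertexSign, cubeVertex, hiA, hiB, if_true, if_false] at h1 h2 ⊢
        linarith
      · have hiA : i ∈ A := by tauto
        simp only [vertexSign, cubeVertex, hiA, hiB, if_true, if_false] at h1 h2 ⊢
        linarith
    obtain ⟨i, hi⟩ : ∃ i, (i ∈ A ↔ i ∉ B) := by
      by_contra! hcon
      apply hAB
      ext i
      have := hcon i
      tauto
    refine Finset.sum_pos' (fun i _ => ?_) ⟨i, Finset.mem_univ i, hterm i hi⟩
    by_cases h : i ∈ A ↔ i ∉ B
    · exact (hterm i h).le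
    · have : i ∈ A ↔ i ∈ B := by tauto
      simp [cubeVertex, this]

theorem theorem4 (n : ℕ) (Θ : MvPolynomial (Fin n) ℝ) (hΘ : Θ.totalDegree ≤ 2)
    (hmax : (1 - 1 / ((n : ℝ) - (if Odd n then 0 else 1))) * (n.choose (n / 2) : ℝ)
      < ((localMaxima Θ).ncard : ℝ)) :
    ∃ S : Finset (Fin n),
      IsAntichain (· ⊆ ·) ((fun A : Finset (Fin n) => A ∆ S) '' localMaxima Θ) := by
  obtain ⟨J, hJ, hd, hF⟩ := exists_form_pos_on_localMaxima Θ hΘ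
  -- For `n = 0` there is no base index for switching, but only one vertex.
  rcases isEmpty_or_nonempty (Fin n) with hn | ⟨⟨o⟩⟩
  · exact ⟨∅, Set.Subsingleton.isAntichain (Set.subsingleton_of_subsingleton) _⟩
  have hfr : ∀ i j k, i ≠ j → i ≠ k → j ≠ k → J i j * J i k * J j k < 0 := by
    intro i j k hij hik hjk
    by_contra hcon
    have hfin : (localMaxima Θ).Finite := Set.toFinite _
    have hle := card_le_of_frustrated hJ hd (F := hfin.toFinset)
      (fun A hA B hB => hF A (hfin.mem_toFinset.1 hA) B (hfin.mem_toFinset.1 hB))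
      hij hik hjk (not_lt.1 hcon)
    rw [← Set.ncard_eq_toFinset_card _ hfin] at hle
    exact absurd hmax (not_lt.2 hle)
  obtain ⟨S, hS⟩ := exists_switching hJ hd o hfr
  exact ⟨S, isAntichain_image_symmDiff hS hF⟩
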